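/- Let $K$ be a field, let $n \ge 1$, and let $K\langle x_1,\dots,x_n\rangle$ be the noncommutative polynomial ring with $x_1 > \cdots > x_n$. Monomials are words in the $x_i$ (including the empty word $1$), and $\deg$ is word length. **Orderings and reduction.** An admissible monomial ordering is a total order on monomials with $1<m$ for $m\neq 1$ and $m_1<m_2\Rightarrow \ell m_1r<\ell m_2r$. It determines the leading monomial $\mathrm{LM}(p)$ and leading coefficient $\mathrm{LC}(p)$ of each $p\ne0$. If the monomial $m=a\,\mathrm{LM}(q)\,b$ occurs in $p$ with coefficient $c\neq0$, then $p$ reduces in one step by $q$ to $p-c\,\mathrm{LC}(q)^{-1}aqb$. A polynomial reduces to zero using a set $P$ if some finite chain of such steps by members of $P$ leads to $0$. **Gröbner bases.** For nonzero $p_1,p_2$ (possibly equal), their leading monomials overlap in $\ell_1\mathrm{LM}(p_1)r_1=\ell_2\mathrm{LM}(p_2)r_2$ if one is a subword of the other, or a nonempty proper prefix of one equals a proper suffix of the other, and the word is the resulting minimal common multiple. The S-polynomial of the overlap is $\mathrm{LC}(p_2)\ell_1p_1r_1-\mathrm{LC}(p_1)\ell_2p_2r_2$. A finite set of nonzero polynomials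 $G$ is a noncommutative Gröbner basis (of the two-sided ideal it generates) if all S-polynomials of members of $G$ (self overlaps included) reduce to zero using $G$. **Involutive divisions.** An involutive division $I$ assigns, for every finite set $U$ of monomials, sets $\mathcal M^L_I(u,U),\mathcal M^R_I(u,U)\subseteq\{x_1,\dots,x_n\}$ of left and right multiplicative variables to every $u\in U$. At a factorisation $w=aub$, $u$ involutively divides $w$ if the last letter of $a$ (if any) lies in $\mathcal M^L_I(u,U)$ and the first letter of $b$ (if any) lies in $\mathcal M^R_I(u,U)$; the involutive cone $\mathcal C_I(u,U)$ is the set of all $w$ that $u$ involutively divides at some factorisation. The division $I$ is strong if, for all finite $U$: (i) any two cones $\mathcal C_I(u_1,U),\mathcal C_I(u_2,U)$ that meet are comparable under inclusion; (ii) each $w\in \mathcal C_I(u,U)$ is involutively divisible by $u$ at only one factorisation; (iii) $V\subseteq U$ and $v \in V$ imply $\mathcal M^{L}_I(v,U)\subseteq\mathcal M^{L}_I(v,V)$ and $\mathcal M^{R}_I(v,U)\subseteq\mathcal M^{R}_I(v,V)$. Otherwise $I$ is weak. For a finite set $P$ of nonzero polynomials, use the multiplicative variables of $U=\{\mathrm{LM}(p):p\in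 P\}$. An involutive reduction step is a reduction step by some $q\in P$ in which $\mathrm{LM}(q)$ involutively divides $a\,\mathrm{LM}(q)\,b$ at that factorisation. The set $P$ is autoreduced if no $p\in P$ contains a monomial involutively divisible by $\mathrm{LM}(p')$ for some $p'\in P\setminus\{p\}$. It is a Locally Involutive Basis with respect to $I$ and the ordering if it is autoreduced and every $x_ip$ with $x_i\notin\mathcal M^L_I(\mathrm{LM}(p),U)$ and every $px_i$ with $x_i\notin\mathcal M^R_I(\mathrm{LM}(p),U)$ ($p\in P$) reduces to zero by involutive reduction steps using $P$. The division $I$ is a Gröbner involutive division if it is weak and, for every admissible monomial ordering, every Locally Involutive Basis with respect to $I$ is a noncommutative Gröbner basis. **The two-sided left overlap division $\mathcal W$.** Sort $U$ as $u_1>\cdots>u_m$ by DegRevLex (a monomial of larger degree is larger; for equal degrees compare letters from right to left, and at the first difference the monomial with the greater letter is the smaller one). Start with all variables left and right multiplicative for all $u_i$. For $i=1,\dots,m$ and, within that, $j=i,\dots,m$, put $\alpha=\deg u_i$, $\beta=\deg u_j$ and do the following, where letters are indexed by position. 1. If $i\ne j$: for $k=1,\dots,\alpha-\beta+1$, if the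 subword of $u_i$ of length $\beta$ starting at position $k$ equals $u_j$, make the letter of $u_i$ at position $k+\beta$ right nonmultiplicative for $u_j$ if $k<\alpha-\beta+1$, and make the letter of $u_i$ at position $k-1$ left nonmultiplicative for $u_j$ if $k=\alpha-\beta+1$. 2. For $k=1,\dots,\beta-1$, in this order: (a) if the prefix of $u_i$ of degree $k$ equals the suffix of $u_j$ of degree $k$, let $x$ be the letter of $u_j$ at position $\beta-k$ and $y$ the letter of $u_i$ at position $k+1$; if currently $x$ is left multiplicative for $u_i$ and $y$ is right multiplicative for $u_j$, make $y$ right nonmultiplicative for $u_j$; (b) if the suffix of $u_i$ of degree $k$ equals the prefix of $u_j$ of degree $k$, let $y$ be the letter of $u_j$ at position $k+1$ and $x$ the letter of $u_i$ at position $\alpha-k$; if currently $y$ is right multiplicative for $u_i$ and $x$ is left multiplicative for $u_j$, make $x$ left nonmultiplicative for $u_j$. **Proposition.** The two-sided left overlap division $\mathcal W$ is a Gröbner involutive division. That is, $\mathcal W$ is a weak involutive division, and for every admissible monomial ordering, every Locally Involutive Basis with respect to $\mathcal W$ is a noncommutative Gröbner basis. -/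

import Mathlib

/-! Noncommutative polynomials `K⟨x₁, …, xₙ⟩` are elements of the monoid algebra of the free monoid
on `Fin n`; the letter `i : Fin n` is the variable `x_{i+1}`, and `x₁ > x₂ > ⋯ > xₙ`. -/

/-- Monomials in `n` noncommuting variables. -/
abbrev NCMon (n : ℕ) : Type := FreeMonoid (Fin n)

instance (n : ℕ) : DecidableEq (NCMon n) := inferInstanceAs (DecidableEq (List (Fin n)))

/-- The noncommutative polynomial ring `K⟨x₁, …, xₙ⟩`. -/
abbrev NCPoly (K : Type*) [Field K] (n : ℕ) : Type _ := MonoidAlgebra K (NCMon n)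

namespace NCPoly

variable {K : Type*} [Field K] {n : ℕ}

/-- The polynomial `c • m` for a coefficient `c` and a monomial `m`. -/
noncomputable def term (m : NCMon n) (c : K) : NCPoly K n := MonoidAlgebra.single m c

/-- A monomial as a polynomial. -/
noncomputable def mon (m : NCMon n) : NCPoly K n := term m 1

/-- The variable with index `x` as a polynomial. -/
noncomputable def var (x : Fin n) : NCPoly K n := mon (FreeMonoid.of x)

end NCPoly

/-! ### Monomial orderings and leading data -/

/-- An admissible monomial ordering: a total order on the monomials with `1 < m` for `m ≠ 1` that is
compatible with multiplication on both sides. -/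
structure AdmissibleOrder (n : ℕ) where
  ord : LinearOrder (NCMon n)
  one_lt : ∀ m : NCMon n, m ≠ 1 → ord.lt 1 m
  mul_lt_mul : ∀ m₁ m₂ l r : NCMon n, ord.lt m₁ m₂ → ord.lt (l * m₁ * r) (l * m₂ * r)

namespace AdmissibleOrder

variable {K : Type*} [Field K] {n : ℕ} (O : AdmissibleOrder n)

/-- The leading monomial of a polynomial (with the value `1` at the zero polynomial). -/
noncomputable def LM (p : NCPoly K n) : NCMon n :=
  open Classical in
  if h : p.coeff.support.Nonempty then @Finset.max' _ O.ord p.coeff.support h else 1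

/-- The leading coefficient. -/
noncomputable def LC (p : NCPoly K n) : K := p.coeff (O.LM p)

/-- The set of leading monomials of a finite set of polynomials. -/
noncomputable def LMs (P : Finset (NCPoly K n)) : Finset (NCMon n) :=
  open Classical in P.image O.LM

end AdmissibleOrder

/-! ### Conventional reduction, S-polynomials, Gröbner bases -/

section Groebner

open NCPoly

variable {K : Type*} [Field K] {n : ℕ}

/-- `r` is obtained from `p` by cancelling the term of `p` with monomial `a * LM q * b`
(which has to occur in `p`) against the multiple `a q b` of `q`. -/
def ReducesAt (O : AdmissibleOrder n) (q : NCPoly K n) (a b : NCMon n) (p r : NCPoly K n) : Prop :=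
  a * O.LM q * b ∈ p.coeff.support ∧
    r = p - term a (p.coeff (a * O.LM q * b) * (O.LC q)⁻¹) * q * mon b

/-- One step of conventional division by a member of `P`. -/
def ReductionStep (O : AdmissibleOrder n) (P : Finset (NCPoly K n)) (p r : NCPoly K n) : Prop :=
  ∃ q ∈ P, ∃ a b : NCMon n, ReducesAt O q a b p r

/-- `p →_P 0`. -/
def ReducesToZero (O : AdmissibleOrder n) (P : Finset (NCPoly K n)) (p : NCPoly K n) : Prop :=
  Relation.ReflTransGen (ReductionStep O P) p 0

/-- The monomials `m₁` and `m₂` overlap in the overlap word `l₁ m₁ r₁ = l₂ m₂ r₂`: either `m₂` is a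
subword of `m₁`, or a nonempty proper prefix of `m₁` is a proper suffix of `m₂`, or a nonempty
proper suffix of `m₁` is a proper prefix of `m₂`. -/
inductive IsOverlap : (m₁ m₂ l₁ r₁ l₂ r₂ : NCMon n) → Prop
  | subword (m₂ l r : NCMon n) : IsOverlap (l * m₂ * r) m₂ 1 1 l r
  | pre (v l r : NCMon n) (hv : v ≠ 1) (hl : l ≠ 1) (hr : r ≠ 1) :
      IsOverlap (v * r) (l * v) l 1 1 r
  | suff (v l r : NCMon n) (hv : v ≠ 1) (hl : l ≠ 1) (hr : r ≠ 1) :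
      IsOverlap (l * v) (v * r) 1 r l 1

/-- The S-polynomial `LC(p₂) l₁ p₁ r₁ - LC(p₁) l₂ p₂ r₂`. -/
noncomputable def SPoly (O : AdmissibleOrder n) (p₁ p₂ : NCPoly K n) (l₁ r₁ l₂ r₂ : NCMon n) :
    NCPoly K n :=
  term l₁ (O.LC p₂) * p₁ * mon r₁ - term l₂ (O.LC p₁) * p₂ * mon r₂

/-- `G` is a noncommutative Gröbner basis for the two-sided ideal `J`: it is a set of nonzero
polynomials generating `J`, and all S-polynomials (self overlaps included) reduce to zero
using `G`. -/
def IsGroebnerBasis (O : AdmissibleOrder n) (G : Finset (NCPoly K n))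
    (J : TwoSidedIdeal (NCPoly K n)) : Prop :=
  0 ∉ G ∧ TwoSidedIdeal.span (G : Set (NCPoly K n)) = J ∧
    ∀ p₁ ∈ G, ∀ p₂ ∈ G, ∀ l₁ r₁ l₂ r₂ : NCMon n,
      IsOverlap (O.LM p₁) (O.LM p₂) l₁ r₁ l₂ r₂ →
        ReducesToZero O G (SPoly O p₁ p₂ l₁ r₁ l₂ r₂)

end Groebner

/-! ### Involutive divisions -/

/-- An assignment, for every finite set `U` of monomials, of sets `left U u` and `right U u` of left
and right multiplicative variables to every `u ∈ U` (values at `u ∉ U` are never used). -/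
structure InvDivision (n : ℕ) where
  left : Finset (NCMon n) → NCMon n → Set (Fin n)
  right : Finset (NCMon n) → NCMon n → Set (Fin n)

namespace InvDivision

variable {K : Type*} [Field K] {n : ℕ} (I : InvDivision n)

/-- `u` involutively divides `a * u * b` at this place (thin divisors): the last letter of `a`,
if it exists, is left multiplicative and the first letter of `b`, if it exists, is right
multiplicative for `u`. -/
def DividesAt (U : Finset (NCMon n)) (u a b : NCMon n) : Prop :=
  (∀ x, a.toList.getLast? = some x → x ∈ I.left U u) ∧
    (∀ x, b.toList.head? = some x → x ∈ I.right U u)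

/-- `u ∣_I w`. -/
def Divides (U : Finset (NCMon n)) (u w : NCMon n) : Prop :=
  ∃ a b : NCMon n, w = a * u * b ∧ I.DividesAt U u a b

/-- The involutive cone of `u` with respect to `U`. -/
def cone (U : Finset (NCMon n)) (u : NCMon n) : Set (NCMon n) := {w | I.Divides U u w}

/-- Strong involutive divisions: the disjoint cones, unique divisor and subset conditions. -/
structure IsStrong : Prop where
  disjoint_cones : ∀ U : Finset (NCMon n), ∀ u₁ ∈ U, ∀ u₂ ∈ U,
    (I.cone U u₁ ∩ I.cone U u₂).Nonempty →
      I.cone U u₁ ⊆ I.cone U u₂ ∨ I.cone U u₂ ⊆ I.cone U u₁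
  unique_divisor : ∀ U : Finset (NCMon n), ∀ u ∈ U, ∀ a b a' b' : NCMon n,
    a * u * b = a' * u * b' → I.DividesAt U u a b → I.DividesAt U u a' b' → a = a' ∧ b = b'
  subset : ∀ U V : Finset (NCMon n), V ⊆ U → ∀ v ∈ V,
    I.left U v ⊆ I.left V v ∧ I.right U v ⊆ I.right V v

/-- An involutive division is weak if it fails one of the conditions for a strong one. -/
def IsWeak : Prop := ¬ I.IsStrong

/-- One step of involutive division by a member of `P`; multiplicative variables are determined by
the set of leading monomials of `P`. -/
def ReductionStep (O : AdmissibleOrder n) (P : Finset (NCPoly K n)) (p r : NCPoly K n) : Prop :=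
  ∃ q ∈ P, ∃ a b : NCMon n, I.DividesAt (O.LMs P) (O.LM q) a b ∧ ReducesAt O q a b p r

/-- `p` involutively reduces to zero using `P`. -/
def ReducesToZero (O : AdmissibleOrder n) (P : Finset (NCPoly K n)) (p : NCPoly K n) : Prop :=
  Relation.ReflTransGen (I.ReductionStep O P) p 0

/-- No `p ∈ P` contains a term that is involutively divisible by some other `p' ∈ P`. -/
def IsAutoreduced (O : AdmissibleOrder n) (P : Finset (NCPoly K n)) : Prop :=
  ∀ p ∈ P, ∀ p' ∈ P, p' ≠ p → ∀ m ∈ p.coeff.support, ¬ I.Divides (O.LMs P) (O.LM p') m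

/-- A Locally Involutive Basis: an autoreduced finite set of nonzero polynomials all of whose left
and right prolongations involutively reduce to zero. -/
structure IsLocallyInvolutiveBasis (O : AdmissibleOrder n) (P : Finset (NCPoly K n)) : Prop where
  zero_notMem : 0 ∉ P
  autoreduced : I.IsAutoreduced O P
  left_prolongation : ∀ p ∈ P, ∀ x : Fin n, x ∉ I.left (O.LMs P) (O.LM p) →
    I.ReducesToZero O P (NCPoly.var x * p)
  right_prolongation : ∀ p ∈ P, ∀ x : Fin n, x ∉ I.right (O.LMs P) (O.LM p) →
    I.ReducesToZero O P (p * NCPoly.var x)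

/-- A Gröbner involutive division (over the coefficient field `K`): a weak involutive division such
that, for every admissible monomial ordering, every Locally Involutive Basis is a Gröbner basis
(for the two-sided ideal that it generates). -/
def IsGroebnerDivision (K : Type*) [Field K] (I : InvDivision n) : Prop :=
  I.IsWeak ∧ ∀ (O : AdmissibleOrder n) (P : Finset (NCPoly K n)),
    I.IsLocallyInvolutiveBasis O P →
      IsGroebnerBasis O P (TwoSidedIdeal.span (P : Set (NCPoly K n)))

end InvDivision

/-! ### The two-sided left overlap division -/

namespace TwoSidedLeftOverlap

variable {n : ℕ}

/-- The prefix of degree `i`. -/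
def pre (m : NCMon n) (i : ℕ) : List (Fin n) := m.toList.take i

/-- The suffix of degree `i` (for `i ≤ deg m`). -/
def suff (m : NCMon n) (i : ℕ) : List (Fin n) := m.toList.drop (m.length - i)

/-- The subword from position `i` to position `j`; positions count from `1`. -/
def sub (m : NCMon n) (i j : ℕ) : List (Fin n) := (m.toList.drop (i - 1)).take (j + 1 - i)

/-- The letter at position `i`; positions count from `1`. -/
def letter (m : NCMon n) (i : ℕ) : Option (Fin n) := if i = 0 then none else m.toList[i - 1]?

/-- The key by which `DegRevLex` compares monomials: first the degree, then the words read from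
right to left. A letter is greater in the variable ordering iff its index is smaller, and in
`DegRevLex` the monomial with the greater letter at the first difference (from the right) is the
smaller one, so the reversed words are compared lexicographically by index. -/
def degRevLexKey (m : NCMon n) : ℕ ×ₗ List (Fin n) := toLex (m.length, m.toList.reverse)

/-- `u ≥ v` in the `DegRevLex` ordering. -/
def DegRevLexGE (u v : NCMon n) : Prop := degRevLexKey v ≤ degRevLexKey u

instance : DecidableRel (DegRevLexGE (n := n)) := fun u v =>
  inferInstanceAs (Decidable (degRevLexKey v ≤ degRevLexKey u))

instance : IsTrans (NCMon n) DegRevLexGE := ⟨fun _ _ _ h₁ h₂ => le_trans h₂ h₁⟩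

instance : Std.Total (DegRevLexGE (n := n)) := ⟨fun _ _ => le_total _ _⟩

instance : Std.Antisymm (DegRevLexGE (n := n)) := ⟨fun u v h₁ h₂ => by
  have h := congrArg (fun k => (ofLex k).2) (le_antisymm h₂ h₁)
  exact FreeMonoid.toList.injective (List.reverse_injective h)⟩

/-- The two sides on which a variable can be multiplicative. -/
inductive Side
  | L
  | R
deriving DecidableEq

/-- A table of left and right multiplicative variables: `true` is multiplicative, `false` is
nonmultiplicative. -/
abbrev Table (n : ℕ) : Type := NCMon n → Side → Fin n → Bool

/-- The assignment `T(u, x^s) = 0`. -/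
def Table.clear (T : Table n) (u : NCMon n) (s : Side) (x : Fin n) : Table n :=
  fun u' s' x' => if u' = u ∧ s' = s ∧ x' = x then false else T u' s' x'

/-- `T(u, x^s) = 0` for the letter `x`, if it exists. -/
def Table.clear? (T : Table n) (u : NCMon n) (s : Side) (x : Option (Fin n)) : Table n :=
  match x with
  | some x => T.clear u s x
  | none => T

/-- The treatment of a subword overlap of `u'` in `u` at position `k`. -/
def subwordStep (u u' : NCMon n) (T : Table n) (k : ℕ) : Table n :=
  if sub u k (k + u'.length - 1) = u'.toList then
    if k < u.length + 1 - u'.length then T.clear? u' .R (letter u (k + u'.length))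
    else T.clear? u' .L (letter u (k - 1))
  else T

/-- If both `T(u, x^L)` and `T(u', y^R)` are `1`, set `T(u', y^R) = 0`, where a prefix of `u` of
degree `k` is a suffix of `u'`, preceded by `x` in `u'` and followed by `y` in `u`. -/
def prefixStep (u u' : NCMon n) (T : Table n) (k : ℕ) : Table n :=
  if pre u k = suff u' k then
    match letter u' (u'.length - k), letter u (k + 1) with
    | some x, some y => if T u .L x && T u' .R y then T.clear u' .R y else T
    | _, _ => T
  else T

/-- If both `T(u, y^R)` and `T(u', x^L)` are `1`, set `T(u', x^L) = 0`, where a suffix of `u` of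
degree `k` is a prefix of `u'`, preceded by `x` in `u` and followed by `y` in `u'`. -/
def suffixStep (u u' : NCMon n) (T : Table n) (k : ℕ) : Table n :=
  if suff u k = pre u' k then
    match letter u' (k + 1), letter u (u.length - k) with
    | some y, some x => if T u .R y && T u' .L x then T.clear u' .L x else T
    | _, _ => T
  else T

/-- The body of the double loop for the pair `(uᵢ, uⱼ) = (u, u')`: first (if `i ≠ j`) the loop
over `1 ≤ k ≤ deg u - deg u' + 1`, then the loop over `1 ≤ k ≤ deg u' - 1`. -/
def pairStep (u : NCMon n) (T : Table n) (u' : NCMon n) : Table n :=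
  let T₁ := if u ≠ u' then
      (List.range' 1 (u.length + 1 - u'.length)).foldl (subwordStep u u') T
    else T
  (List.range' 1 (u'.length - 1)).foldl (fun T k => suffixStep u u' (prefixStep u u' T k) k) T₁

/-- The double loop over all pairs `(uᵢ, uⱼ)` with `i ≤ j` of a list `u₁, …, uₘ`. -/
def run : List (NCMon n) → Table n → Table n
  | [], T => T
  | u :: us, T => run us ((u :: us).foldl (pairStep u) T)

/-- The table of multiplicative variables for `U`: sort `U` by `DegRevLex`, greatest first, start
with all variables multiplicative, and run the double loop. -/
def table (U : Finset (NCMon n)) : Table n := run (U.sort DegRevLexGE) (fun _ _ _ => true)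

end TwoSidedLeftOverlap

/-- The two-sided left overlap division `𝒲`. -/
def twoSidedLeftOverlapDivision (n : ℕ) : InvDivision n where
  left U u := {x | TwoSidedLeftOverlap.table U u .L x = true}
  right U u := {x | TwoSidedLeftOverlap.table U u .R x = true}

/-!
The multiplicative variables enter the proof only through three facts (`DetectsOverlaps`), which
the division has because its table only ever loses multiplicative variables, and because its loop
treats every pair of words with the larger one first:

* a member of `U` occurring properly in another one, with a letter to the right of the occurrence,
  has this letter as right nonmultiplicative variable;
* a member of `U` that is a proper suffix of another one has the letter before it as left
  nonmultiplicative variable;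
* if a suffix of `u'` overlaps a prefix of `u`, the letter of `u` after the common part is right
  nonmultiplicative for `u'`, or the letter of `u'` before it is left nonmultiplicative for `u`.

For a word `w`, consider the occurrences of leading monomials of `P` in `w`, and call two of them
equivalent if the monic multiples `a q b`, `a' q' b'` they stand for differ by a combination of
multiples of members of `P` with leading monomials less than `w` (`lowerSpan`). If all occurrences
in all words are equivalent (`Resolves`), then every combination of multiples reduces to zero, by
induction on the bounding word; this uses that admissible orderings are well-founded, a consequence
of Higman's lemma. In particular all S-polynomials reduce to zero (`isGroebnerBasis_of_resolves`).

For a Locally Involutive Basis, the involutive reduction to zero of a prolongation `x p` or `p x`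
cancels its leading monomial in exactly one step, so the occurrence of `LM p` is equivalent to an
*involutive* occurrence in the prolonged word. Equivalence of all occurrences in `w` is proved by
induction on `w`.

* If `w` is itself a leading monomial, the first fact forbids that the involutive occurrence has a
  letter to its right within the prolonged word. Prolonging to the right therefore moves any
  occurrence to the right until it is a suffix, and by the second fact prolonging a suffix to the
  left then gives a longer suffix, until `w` is reached (`monicMul_sub_mem_of_eq_LM`).
* Otherwise, two occurrences inside a common proper subword are equivalent by induction, and
  disjoint ones are equivalent trivially. There remains a prefix overlapping a suffix. By the third
  fact one of them has a nonmultiplicative prolongation, which by the first two facts produces a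
  longer prefix or suffix, or an occurrence sharing a proper subword with the other one
  (`monicMul_sub_mem_of_prefix_suffix`).

The division is weak since `x` divides `x * x` at two places when `U = {x}`.
-/

/-! ### Admissible orderings are well-orderings -/

namespace AdmissibleOrder

variable {n : ℕ} (O : AdmissibleOrder n)

lemma lt_trans {a b c : NCMon n} (h₁ : O.ord.lt a b) (h₂ : O.ord.lt b c) : O.ord.lt a c :=
  letI := O.ord
  _root_.lt_trans h₁ h₂

lemma lt_irrefl (a : NCMon n) : ¬ O.ord.lt a a :=
  letI := O.ord
  _root_.lt_irrefl a

lemma lt_of_le_of_lt {a b c : NCMon n} (h₁ : O.ord.le a b) (h₂ : O.ord.lt b c) : O.ord.lt a c :=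
  letI := O.ord
  _root_.lt_of_le_of_lt h₁ h₂

lemma le_iff_lt_or_eq {a b : NCMon n} : O.ord.le a b ↔ O.ord.lt a b ∨ a = b :=
  letI := O.ord
  _root_.le_iff_lt_or_eq

lemma le_refl (a : NCMon n) : O.ord.le a a := O.ord.le_refl a

lemma lt_trichotomy (a b : NCMon n) : O.ord.lt a b ∨ a = b ∨ O.ord.lt b a :=
  letI := O.ord
  _root_.lt_trichotomy a b

lemma mul_le_mul {m₁ m₂ : NCMon n} (h : O.ord.le m₁ m₂) (l r : NCMon n) :
    O.ord.le (l * m₁ * r) (l * m₂ * r) := by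
  rcases O.le_iff_lt_or_eq.1 h with h | rfl
  · exact O.le_iff_lt_or_eq.2 (.inl (O.mul_lt_mul _ _ _ _ h))
  · exact O.le_refl _

lemma one_le (m : NCMon n) : O.ord.le 1 m := by
  by_cases h : m = 1
  · exact O.le_iff_lt_or_eq.2 (.inr h.symm)
  · exact O.le_iff_lt_or_eq.2 (.inl (O.one_lt m h))

lemma self_lt_mul {l r : NCMon n} (h : l ≠ 1 ∨ r ≠ 1) (m : NCMon n) : O.ord.lt m (l * m * r) := by
  have hl : O.ord.le m (l * m) := by simpa using O.mul_le_mul (O.one_le l) 1 m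
  by_cases hr : r = 1
  · subst hr
    simpa using O.mul_lt_mul _ _ 1 m (O.one_lt l (by simpa using h))
  · have := O.mul_lt_mul _ _ (l * m) 1 (O.one_lt r hr)
    exact O.lt_of_le_of_lt hl (by simpa using this)

/-- An admissible ordering extends the ordering of words by embedding as (scattered) subwords. -/
lemma le_of_sublist {u v : List (Fin n)} (h : u.Sublist v) :
    O.ord.le (FreeMonoid.ofList u) (FreeMonoid.ofList v) := by
  induction h with
  | slnil => exact O.le_refl _
  | @cons u v a _ ih =>
    have h2 := O.mul_le_mul (O.one_le (FreeMonoid.of a)) 1 (FreeMonoid.ofList v)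
    simp only [one_mul] at h2
    exact O.ord.le_trans _ _ _ ih h2
  | @cons_cons u v a _ ih =>
    have := O.mul_le_mul ih (FreeMonoid.of a) 1
    simp only [mul_one] at this
    exact this

/-- By Higman's lemma every infinite sequence of words contains a word that embeds in a later one,
so it cannot be strictly decreasing. -/
lemma wellFounded_lt : WellFounded O.ord.lt := by
  have : IsStrictOrder (NCMon n) O.ord.lt :=
    { irrefl := O.lt_irrefl, trans := fun _ _ _ => O.lt_trans }
  rw [RelEmbedding.wellFounded_iff_isEmpty]
  refine ⟨fun f => ?_⟩
  have hp : (Set.univ : Set (Fin n)).PartiallyWellOrderedOn (· = ·) :=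
    Set.finite_univ.partiallyWellOrderedOn
  obtain ⟨i, j, hij, h⟩ := Set.PartiallyWellOrderedOn.partiallyWellOrderedOn_sublistForall₂ _ hp
    (fun i => ⟨(f i).toList, by simp⟩)
  obtain ⟨l, hl, hs⟩ := List.sublistForall₂_iff.1 h
  rw [List.forall₂_eq_eq_eq] at hl
  subst hl
  exact O.lt_irrefl _ (O.lt_of_le_of_lt (O.le_of_sublist hs) (f.map_rel_iff.2 hij))

end AdmissibleOrder

/-! ### Leading terms and multiples -/

namespace AdmissibleOrder

open NCPoly

variable {K : Type*} [Field K] {n : ℕ} (O : AdmissibleOrder n)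

lemma LM_mem_support {p : NCPoly K n} (hp : p ≠ 0) : O.LM p ∈ p.coeff.support := by
  have h : p.coeff.support.Nonempty := by simpa [Finsupp.support_nonempty_iff] using hp
  rw [LM, dif_pos h]
  exact @Finset.max'_mem _ O.ord _ h

lemma le_LM {p : NCPoly K n} {m : NCMon n} (hm : m ∈ p.coeff.support) : O.ord.le m (O.LM p) := by
  have h : p.coeff.support.Nonempty := ⟨m, hm⟩
  rw [LM, dif_pos h]
  exact @Finset.le_max' _ O.ord _ m hm

lemma LC_ne_zero {p : NCPoly K n} (hp : p ≠ 0) : O.LC p ≠ 0 :=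
  Finsupp.mem_support_iff.1 (O.LM_mem_support hp)

end AdmissibleOrder

namespace NCPoly

variable {K : Type*} [Field K] {n : ℕ}

lemma term_eq_smul_mon (m : NCMon n) (c : K) : term m c = c • mon m := by
  simp [term, mon]

lemma mon_mul_mon (a b : NCMon n) : (mon a * mon b : NCPoly K n) = mon (a * b) := by
  simp [mon, term, MonoidAlgebra.single_mul_single]

lemma mon_one : (mon 1 : NCPoly K n) = 1 := rfl

lemma coeff_mon_mul_mul_mon (p : NCPoly K n) (a b m : NCMon n) :
    (mon a * p * mon b).coeff (a * m * b) = p.coeff m := by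
  simp only [mon, term]
  rw [MonoidAlgebra.coeff_mul_single_mul, MonoidAlgebra.coeff_single_mul_mul]
  simp

lemma exists_of_mem_support_mon_mul_mul_mon {p : NCPoly K n} {a b m : NCMon n}
    (h : m ∈ (mon a * p * mon b).coeff.support) : ∃ m' ∈ p.coeff.support, m = a * m' * b := by
  classical
  have h1 := MonoidAlgebra.support_coeff_mul_single_subset _ _ _ h
  obtain ⟨m1, hm1, rfl⟩ := Finset.mem_image.1 h1
  obtain ⟨m2, hm2, rfl⟩ := Finset.mem_image.1
    (MonoidAlgebra.support_coeff_single_mul_subset _ _ _ hm1)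
  exact ⟨m2, hm2, rfl⟩

/-- The polynomial `p` is the sum of its terms. -/
lemma eq_sum_smul_mon (p : NCPoly K n) :
    p = ∑ m ∈ p.coeff.support, p.coeff m • (mon m : NCPoly K n) := by
  ext m
  simp [mon, term, Finsupp.single_apply]

end NCPoly

namespace AdmissibleOrder

open NCPoly

variable {K : Type*} [Field K] {n : ℕ} (O : AdmissibleOrder n)

/-- The multiple `a q b`, normalised to have leading coefficient `1`. -/
noncomputable def monicMul (a : NCMon n) (q : NCPoly K n) (b : NCMon n) : NCPoly K n :=
  (O.LC q)⁻¹ • (mon a * q * mon b)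

lemma mon_mul_monicMul_mul_mon (l r a b : NCMon n) (q : NCPoly K n) :
    mon l * O.monicMul a q b * mon r = O.monicMul (l * a) q (b * r) := by
  simp only [monicMul, ← mon_mul_mon, mul_smul_comm, smul_mul_assoc, mul_assoc]

lemma LC_smul_monicMul {q : NCPoly K n} (hq : q ≠ 0) (a b : NCMon n) :
    O.LC q • O.monicMul a q b = mon a * q * mon b := by
  rw [monicMul, smul_inv_smul₀ (O.LC_ne_zero hq)]

lemma coeff_monicMul {q : NCPoly K n} (hq : q ≠ 0) (a b : NCMon n) :
    (O.monicMul a q b).coeff (a * O.LM q * b) = 1 := by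
  rw [monicMul, MonoidAlgebra.coeff_smul_apply, coeff_mon_mul_mul_mon]
  exact inv_mul_cancel₀ (O.LC_ne_zero hq)

lemma le_of_mem_support_monicMul {q : NCPoly K n} {a b m : NCMon n}
    (h : m ∈ (O.monicMul a q b).coeff.support) : O.ord.le m (a * O.LM q * b) := by
  rw [monicMul, MonoidAlgebra.coeff_smul] at h
  obtain ⟨m', hm', rfl⟩ := exists_of_mem_support_mon_mul_mul_mon (Finsupp.support_smul h)
  exact O.mul_le_mul (O.le_LM hm') _ _

lemma reducesAt_iff {q p r : NCPoly K n} {a b : NCMon n} :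
    ReducesAt O q a b p r ↔ a * O.LM q * b ∈ p.coeff.support ∧
      r = p - p.coeff (a * O.LM q * b) • O.monicMul a q b := by
  simp only [ReducesAt, monicMul, term_eq_smul_mon, smul_smul, smul_mul_assoc]

/-- The span of the multiples `a q b` of members of `P` with leading monomial less than `w`. -/
noncomputable def lowerSpan (P : Finset (NCPoly K n)) (w : NCMon n) : Submodule K (NCPoly K n) :=
  Submodule.span K {f | ∃ q ∈ P, ∃ a b, O.ord.lt (a * O.LM q * b) w ∧ f = mon a * q * mon b}

variable {P : Finset (NCPoly K n)}

lemma mul_mem_lowerSpan {q : NCPoly K n} (hq : q ∈ P) {a b w : NCMon n}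
    (h : O.ord.lt (a * O.LM q * b) w) : mon a * q * mon b ∈ O.lowerSpan P w :=
  Submodule.subset_span ⟨q, hq, a, b, h, rfl⟩

lemma monicMul_mem_lowerSpan {q : NCPoly K n} (hq : q ∈ P) {a b w : NCMon n}
    (h : O.ord.lt (a * O.LM q * b) w) : O.monicMul a q b ∈ O.lowerSpan P w :=
  Submodule.smul_mem _ _ (O.mul_mem_lowerSpan hq h)

lemma lowerSpan_mono {v w : NCMon n} (h : O.ord.lt v w) : O.lowerSpan P v ≤ O.lowerSpan P w := by
  refine Submodule.span_mono ?_
  rintro f ⟨q, hq, a, b, hab, rfl⟩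
  exact ⟨q, hq, a, b, O.lt_trans hab h, rfl⟩

lemma mon_mul_mul_mon_mem_lowerSpan {f : NCPoly K n} {w : NCMon n} (hf : f ∈ O.lowerSpan P w)
    (l r : NCMon n) : mon l * f * mon r ∈ O.lowerSpan P (l * w * r) := by
  induction hf using Submodule.span_induction with
  | mem f hf =>
    obtain ⟨q, hq, a, b, hab, rfl⟩ := hf
    have h := O.mul_lt_mul _ _ l r hab
    have := O.mul_mem_lowerSpan (a := l * a) (b := b * r) (w := l * w * r) hq
      (by simpa only [mul_assoc] using h)
    simpa only [← mon_mul_mon, mul_assoc] using this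
  | zero => simp
  | add f g _ _ hf hg => simpa [mul_add, add_mul] using add_mem hf hg
  | smul c f _ hf => simpa using Submodule.smul_mem _ c hf

lemma lt_of_mem_lowerSpan {f : NCPoly K n} {w : NCMon n} (hf : f ∈ O.lowerSpan P w) :
    ∀ m ∈ f.coeff.support, O.ord.lt m w := by
  classical
  induction hf using Submodule.span_induction with
  | mem f hf =>
    obtain ⟨q, hq, a, b, hab, rfl⟩ := hf
    intro m hm
    obtain ⟨m', hm', rfl⟩ := exists_of_mem_support_mon_mul_mul_mon hm
    exact O.lt_of_le_of_lt (O.mul_le_mul (O.le_LM hm') _ _) hab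
  | zero => simp
  | add f g _ _ hf hg =>
    intro m hm
    rw [MonoidAlgebra.coeff_add] at hm
    rcases Finset.mem_union.1 (Finsupp.support_add hm) with h | h
    exacts [hf m h, hg m h]
  | smul c f _ hf =>
    intro m hm
    rw [MonoidAlgebra.coeff_smul] at hm
    exact hf m (Finsupp.support_smul hm)

lemma coeff_eq_zero_of_mem_lowerSpan {f : NCPoly K n} {w : NCMon n} (hf : f ∈ O.lowerSpan P w) :
    f.coeff w = 0 := by
  by_contra h
  exact O.lt_irrefl _ (O.lt_of_mem_lowerSpan hf w (Finsupp.mem_support_iff.2 h))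

/-- Two occurrences that lie side by side cancel: with `p = LC p • (LM p) + p̃` and `q` likewise,
`p c (LM q) - (LM p) c q = p̃ c q - p c q̃` up to normalisation. -/
lemma monicMul_sub_monicMul_mem_of_disjoint {p q : NCPoly K n} (hp : p ∈ P) (hq : q ∈ P)
    (hp0 : p ≠ 0) (hq0 : q ≠ 0) (c : NCMon n) :
    O.monicMul 1 p (c * O.LM q) - O.monicMul (O.LM p * c) q 1 ∈
      O.lowerSpan P (O.LM p * c * O.LM q) := by
  classical
  -- the part of a polynomial below its leading term
  set tail : NCPoly K n → NCPoly K n := fun f => f - O.LC f • mon (O.LM f) with htail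
  have tail_supp : ∀ f : NCPoly K n, ∀ m ∈ (tail f).coeff.support, O.ord.lt m (O.LM f) := by
    intro f m hm
    have hm' := Finsupp.mem_support_iff.1 hm
    by_cases h : m = O.LM f
    · subst h
      simp [htail, mon, term, LC] at hm'
    · have : m ∈ f.coeff.support := by
        rw [Finsupp.mem_support_iff]
        intro h0
        apply hm'
        simp [htail, mon, term, h0, Ne.symm h]
      exact (O.le_iff_lt_or_eq.1 (O.le_LM this)).resolve_right h
  have h1 : p * mon c * tail q ∈ O.lowerSpan P (O.LM p * c * O.LM q) := by
    rw [eq_sum_smul_mon (tail q), Finset.mul_sum]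
    refine sum_mem fun m hm => ?_
    rw [mul_smul_comm]
    refine Submodule.smul_mem _ _ ?_
    have hlt := O.mul_lt_mul _ _ (O.LM p * c) 1 (tail_supp q m hm)
    have := O.mul_mem_lowerSpan (a := 1) (b := c * m) (w := O.LM p * c * O.LM q) hp
      (by simpa [mul_assoc] using hlt)
    simpa only [mon_one, one_mul, ← mon_mul_mon, mul_assoc] using this
  have h2 : tail p * mon c * q ∈ O.lowerSpan P (O.LM p * c * O.LM q) := by
    rw [eq_sum_smul_mon (tail p), Finset.sum_mul, Finset.sum_mul]
    refine sum_mem fun m hm => ?_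
    rw [smul_mul_assoc, smul_mul_assoc]
    refine Submodule.smul_mem _ _ ?_
    have hlt := O.mul_lt_mul _ _ 1 (c * O.LM q) (tail_supp p m hm)
    have := O.mul_mem_lowerSpan (a := m * c) (b := 1) (w := O.LM p * c * O.LM q) hq
      (by simpa [mul_assoc] using hlt)
    simpa only [mon_one, mul_one, ← mon_mul_mon, mul_assoc] using this
  have key : O.monicMul 1 p (c * O.LM q) - O.monicMul (O.LM p * c) q 1 =
      ((O.LC p)⁻¹ * (O.LC q)⁻¹) • (tail p * mon c * q - p * mon c * tail q) := by
    have hp' := O.LC_ne_zero hp0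
    have hq' := O.LC_ne_zero hq0
    simp only [htail, monicMul, mon_one, one_mul, mul_one, ← mon_mul_mon, sub_mul, mul_sub,
      smul_mul_assoc, mul_smul_comm, smul_sub, smul_smul, mul_assoc]
    rw [inv_mul_cancel₀ hq', mul_comm (O.LC q)⁻¹ (O.LC p), inv_mul_cancel_left₀ hp', mul_one]
    abel
  rw [key]
  exact Submodule.smul_mem _ _ (sub_mem h2 h1)

end AdmissibleOrder

/-! ### A Gröbner basis criterion -/

namespace AdmissibleOrder

open NCPoly

variable {K : Type*} [Field K] {n : ℕ} (O : AdmissibleOrder n) {P : Finset (NCPoly K n)}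

/-- Any two occurrences of leading monomials of `P` in the word `w` are equivalent: the
corresponding monic multiples differ by a combination of multiples with smaller leading
monomials. -/
def Resolves (P : Finset (NCPoly K n)) (w : NCMon n) : Prop :=
  ∀ q ∈ P, ∀ q' ∈ P, ∀ a b a' b' : NCMon n, a * O.LM q * b = w → a' * O.LM q' * b' = w →
    O.monicMul a q b - O.monicMul a' q' b' ∈ O.lowerSpan P w

lemma exists_smul_monicMul_of_mem_lowerSpan (h0 : 0 ∉ P) (hres : ∀ w, O.Resolves P w)
    {f : NCPoly K n} {w : NCMon n} (hf : f ∈ O.lowerSpan P w) :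
    f = 0 ∨ ∃ q ∈ P, ∃ a b : NCMon n, O.ord.lt (a * O.LM q * b) w ∧
      ∃ c : K, f - c • O.monicMul a q b ∈ O.lowerSpan P (a * O.LM q * b) := by
  induction hf using Submodule.span_induction with
  | mem f hf =>
    obtain ⟨q, hq, a, b, hab, rfl⟩ := hf
    refine .inr ⟨q, hq, a, b, hab, O.LC q, ?_⟩
    rw [O.LC_smul_monicMul (ne_of_mem_of_not_mem hq h0), sub_self]
    exact zero_mem _
  | zero => exact .inl rfl
  | add f g _ _ hf hg =>
    have mem_of_lt : ∀ {f : NCPoly K n} {q : NCPoly K n} {a b v : NCMon n} {c : K}, q ∈ P →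
        f - c • O.monicMul a q b ∈ O.lowerSpan P (a * O.LM q * b) →
        O.ord.lt (a * O.LM q * b) v → f ∈ O.lowerSpan P v := by
      intro f q a b v c hq hf hlt
      simpa using add_mem (O.lowerSpan_mono hlt hf)
        (Submodule.smul_mem _ c (O.monicMul_mem_lowerSpan hq hlt))
    rcases hf with rfl | ⟨q, hq, a, b, hab, c, hf⟩
    · simpa using hg
    rcases hg with rfl | ⟨q', hq', a', b', hab', c', hg⟩
    · exact .inr ⟨q, hq, a, b, hab, c, by simpa using hf⟩
    rcases O.lt_trichotomy (a * O.LM q * b) (a' * O.LM q' * b') with h | h | h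
    · refine .inr ⟨q', hq', a', b', hab', c', ?_⟩
      rw [add_sub_assoc]
      exact add_mem (mem_of_lt hq hf h) hg
    · refine .inr ⟨q, hq, a, b, hab, c + c', ?_⟩
      have hdiff := hres _ q' hq' q hq a' b' a b h.symm rfl
      rw [← h] at hg
      have := add_mem (add_mem hf hg) (Submodule.smul_mem _ c' hdiff)
      convert this using 1
      rw [smul_sub, add_smul]
      abel
    · refine .inr ⟨q, hq, a, b, hab, c, ?_⟩
      rw [add_sub_right_comm]
      exact add_mem hf (mem_of_lt hq' hg h)
  | smul r f _ hf =>
    rcases hf with rfl | ⟨q, hq, a, b, hab, c, hf⟩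
    · simp
    · refine .inr ⟨q, hq, a, b, hab, r * c, ?_⟩
      rw [mul_smul, ← smul_sub]
      exact Submodule.smul_mem _ r hf

/-- If all occurrences are equivalent, the top term of a combination of multiples can be cancelled
by a single reduction step, and the remainder is again such a combination. -/
lemma reducesToZero_of_mem_lowerSpan (h0 : 0 ∉ P) (hres : ∀ w, O.Resolves P w) (w : NCMon n) :
    ∀ f ∈ O.lowerSpan P w, ReducesToZero O P f := by
  induction w using O.wellFounded_lt.induction with
  | _ w ih =>
    intro f hf
    rcases O.exists_smul_monicMul_of_mem_lowerSpan h0 hres hf with rfl | ⟨q, hq, a, b, hab, c, hg⟩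
    · exact Relation.ReflTransGen.refl
    have hgred := ih _ hab _ hg
    by_cases hc : c = 0
    · simpa [hc] using hgred
    have hcoeff : f.coeff (a * O.LM q * b) = c := by
      have h1 := O.coeff_eq_zero_of_mem_lowerSpan hg
      rw [MonoidAlgebra.coeff_sub, Finsupp.sub_apply, MonoidAlgebra.coeff_smul_apply,
        O.coeff_monicMul (ne_of_mem_of_not_mem hq h0), smul_eq_mul, mul_one, sub_eq_zero] at h1
      exact h1
    refine Relation.ReflTransGen.head ⟨q, hq, a, b, O.reducesAt_iff.2 ⟨?_, ?_⟩⟩ hgred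
    · rw [Finsupp.mem_support_iff, hcoeff]
      exact hc
    · rw [hcoeff]

lemma _root_.IsOverlap.mul_eq {m₁ m₂ l₁ r₁ l₂ r₂ : NCMon n} (h : IsOverlap m₁ m₂ l₁ r₁ l₂ r₂) :
    l₁ * m₁ * r₁ = l₂ * m₂ * r₂ := by
  cases h <;> simp [mul_assoc]

theorem isGroebnerBasis_of_resolves (h0 : 0 ∉ P) (hres : ∀ w, O.Resolves P w) :
    IsGroebnerBasis O P (TwoSidedIdeal.span (P : Set (NCPoly K n))) := by
  refine ⟨h0, rfl, fun p₁ h₁ p₂ h₂ l₁ r₁ l₂ r₂ hov => ?_⟩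
  refine O.reducesToZero_of_mem_lowerSpan h0 hres (l₁ * O.LM p₁ * r₁) _ ?_
  have hdiff := hres _ p₁ h₁ p₂ h₂ l₁ r₁ l₂ r₂ rfl hov.mul_eq.symm
  have hS : SPoly O p₁ p₂ l₁ r₁ l₂ r₂ =
      (O.LC p₁ * O.LC p₂) • (O.monicMul l₁ p₁ r₁ - O.monicMul l₂ p₂ r₂) := by
    rw [smul_sub, mul_smul, smul_comm, mul_smul, O.LC_smul_monicMul (ne_of_mem_of_not_mem h₁ h0),
      O.LC_smul_monicMul (ne_of_mem_of_not_mem h₂ h0)]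
    simp only [SPoly, term_eq_smul_mon, smul_mul_assoc]
  rw [hS]
  exact Submodule.smul_mem _ _ hdiff

lemma monicMul_sub_monicMul_mem_mul {q q' : NCPoly K n} {a b a' b' v : NCMon n}
    (h : O.monicMul a q b - O.monicMul a' q' b' ∈ O.lowerSpan P v) (l r : NCMon n) :
    O.monicMul (l * a) q (b * r) - O.monicMul (l * a') q' (b' * r) ∈
      O.lowerSpan P (l * v * r) := by
  have := O.mon_mul_mul_mon_mem_lowerSpan h l r
  rwa [mul_sub, sub_mul, mon_mul_monicMul_mul_mon, mon_mul_monicMul_mul_mon] at this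

end AdmissibleOrder

/-! ### Occurrences provided by the prolongations -/

namespace InvDivision

open NCPoly

variable {K : Type*} [Field K] {n : ℕ} {I : InvDivision n} {O : AdmissibleOrder n}
  {P : Finset (NCPoly K n)}

/-- In an involutive reduction to zero, the monomial `w` (an upper bound for the monomials of `f`)
either does not occur in `f`, or is cancelled in exactly one step of the chain. -/
lemma exists_of_reducesToZero (h0 : 0 ∉ P) {w : NCMon n} {f : NCPoly K n}
    (hred : I.ReducesToZero O P f) (hw : ∀ m ∈ f.coeff.support, O.ord.le m w) :
    f ∈ O.lowerSpan P w ∨ ∃ q ∈ P, ∃ a b : NCMon n, a * O.LM q * b = w ∧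
      I.DividesAt (O.LMs P) (O.LM q) a b ∧
      f - f.coeff w • O.monicMul a q b ∈ O.lowerSpan P w := by
  classical
  induction hred using Relation.ReflTransGen.head_induction_on with
  | refl => exact .inl (zero_mem _)
  | @head f g hstep _ ih =>
    obtain ⟨q, hq, a, b, hdiv, hat⟩ := hstep
    obtain ⟨hmem, rfl⟩ := O.reducesAt_iff.1 hat
    have hq0 : q ≠ 0 := ne_of_mem_of_not_mem hq h0
    set c := f.coeff (a * O.LM q * b) with hc
    have hle : O.ord.le (a * O.LM q * b) w := hw _ hmem
    have hw' : ∀ m ∈ (f - c • O.monicMul a q b).coeff.support, O.ord.le m w := by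
      intro m hm
      rw [MonoidAlgebra.coeff_sub] at hm
      rcases Finset.mem_union.1 (Finsupp.support_sub hm) with h | h
      · exact hw m h
      · rw [MonoidAlgebra.coeff_smul] at h
        exact O.ord.le_trans _ _ _ (O.le_of_mem_support_monicMul (Finsupp.support_smul h)) hle
    rcases O.le_iff_lt_or_eq.1 hle with hlt | heq
    · have hmul := Submodule.smul_mem _ c (O.monicMul_mem_lowerSpan (P := P) hq hlt)
      have hcw : (f - c • O.monicMul a q b).coeff w = f.coeff w := by
        have := O.coeff_eq_zero_of_mem_lowerSpan hmul
        rw [MonoidAlgebra.coeff_sub, Finsupp.sub_apply, this, sub_zero]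
      rcases ih hw' with h | ⟨q', hq', a', b', hw2, hdiv', h⟩
      · exact .inl (by simpa using add_mem h hmul)
      · refine .inr ⟨q', hq', a', b', hw2, hdiv', ?_⟩
        rw [hcw] at h
        convert add_mem h hmul using 1
        abel
    · subst heq
      refine .inr ⟨q, hq, a, b, rfl, hdiv, ?_⟩
      have hcw : (f - c • O.monicMul a q b).coeff (a * O.LM q * b) = 0 := by
        rw [MonoidAlgebra.coeff_sub, Finsupp.sub_apply, MonoidAlgebra.coeff_smul_apply,
          O.coeff_monicMul hq0, smul_eq_mul, mul_one, hc, sub_self]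
      rcases ih hw' with h | ⟨q', hq', a', b', hw2, hdiv', h⟩
      · exact h
      · rwa [hcw, zero_smul, sub_zero] at h

lemma exists_of_mul_reducesToZero (h0 : 0 ∉ P) {p : NCPoly K n} (hp : p ∈ P) {l r : NCMon n}
    (hred : I.ReducesToZero O P (mon l * p * mon r)) :
    ∃ q ∈ P, ∃ a b : NCMon n, a * O.LM q * b = l * O.LM p * r ∧
      I.DividesAt (O.LMs P) (O.LM q) a b ∧
      O.monicMul l p r - O.monicMul a q b ∈ O.lowerSpan P (l * O.LM p * r) := by
  have hp0 : p ≠ 0 := ne_of_mem_of_not_mem hp h0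
  have hc : (mon l * p * mon r : NCPoly K n).coeff (l * O.LM p * r) = O.LC p :=
    coeff_mon_mul_mul_mon _ _ _ _
  rcases exists_of_reducesToZero h0 (w := l * O.LM p * r) hred (fun m hm => by
    obtain ⟨m', hm', rfl⟩ := exists_of_mem_support_mon_mul_mul_mon hm
    exact O.mul_le_mul (O.le_LM hm') _ _) with h | ⟨q, hq, a, b, hab, hdiv, h⟩
  · exact absurd (hc.symm.trans (O.coeff_eq_zero_of_mem_lowerSpan h)) (O.LC_ne_zero hp0)
  · refine ⟨q, hq, a, b, hab, hdiv, ?_⟩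
    rw [hc, ← O.LC_smul_monicMul hp0, ← smul_sub] at h
    simpa [smul_smul, inv_mul_cancel₀ (O.LC_ne_zero hp0)] using
      Submodule.smul_mem _ (O.LC p)⁻¹ h

namespace IsLocallyInvolutiveBasis

lemma exists_of_notMem_left (h : I.IsLocallyInvolutiveBasis O P) {p : NCPoly K n}
    (hp : p ∈ P) {x : Fin n} (hx : x ∉ I.left (O.LMs P) (O.LM p)) :
    ∃ q ∈ P, ∃ a b : NCMon n, a * O.LM q * b = FreeMonoid.of x * O.LM p ∧
      I.DividesAt (O.LMs P) (O.LM q) a b ∧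
      O.monicMul (FreeMonoid.of x) p 1 - O.monicMul a q b ∈
        O.lowerSpan P (FreeMonoid.of x * O.LM p) := by
  have := exists_of_mul_reducesToZero h.zero_notMem hp (l := FreeMonoid.of x) (r := 1)
    (by simpa [mon_one, var] using h.left_prolongation p hp x hx)
  simpa only [mul_one] using this

lemma exists_of_notMem_right (h : I.IsLocallyInvolutiveBasis O P) {p : NCPoly K n}
    (hp : p ∈ P) {x : Fin n} (hx : x ∉ I.right (O.LMs P) (O.LM p)) :
    ∃ q ∈ P, ∃ a b : NCMon n, a * O.LM q * b = O.LM p * FreeMonoid.of x ∧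
      I.DividesAt (O.LMs P) (O.LM q) a b ∧
      O.monicMul 1 p (FreeMonoid.of x) - O.monicMul a q b ∈
        O.lowerSpan P (O.LM p * FreeMonoid.of x) := by
  have := exists_of_mul_reducesToZero h.zero_notMem hp (l := 1) (r := FreeMonoid.of x)
    (by simpa [mon_one, var] using h.right_prolongation p hp x hx)
  simpa only [one_mul] using this

lemma LM_injOn (h : I.IsLocallyInvolutiveBasis O P) {p q : NCPoly K n}
    (hp : p ∈ P) (hq : q ∈ P) (hpq : O.LM p = O.LM q) : p = q := by
  by_contra hne
  refine h.autoreduced p hp q hq (Ne.symm hne) (O.LM p)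
    (O.LM_mem_support (ne_of_mem_of_not_mem hp h.zero_notMem)) ⟨1, 1, by simp [hpq], ?_⟩
  constructor <;> simp

end IsLocallyInvolutiveBasis

end InvDivision

/-! ### Words -/

namespace FreeMonoid

variable {α : Type*}

lemma exists_eq_of_mul {b : FreeMonoid α} (hb : b ≠ 1) : ∃ y b', b = of y * b' := by
  cases b using FreeMonoid.casesOn with
  | one => exact absurd rfl hb
  | of_mul y b' => exact ⟨y, b', rfl⟩

lemma exists_eq_mul_of {a : FreeMonoid α} (ha : a ≠ 1) : ∃ a' x, a = a' * of x := by
  rcases List.eq_nil_or_concat' a.toList with h | ⟨a', x, h⟩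
  · exact absurd (toList.injective h) ha
  · exact ⟨ofList a', x, toList.injective h⟩

/-- A prefix `u` and a suffix `u'` of a word lie side by side or overlap in a nonempty word. -/
lemma disjoint_or_overlap {u b a u' : FreeMonoid α} (h : u * b = a * u') :
    (∃ c, a = u * c ∧ b = c * u') ∨ ∃ c, c ≠ 1 ∧ u = a * c ∧ u' = c * b := by
  rcases List.append_eq_append_iff.1 (show u.toList ++ b.toList = a.toList ++ u'.toList from h)
    with ⟨c, h1, h2⟩ | ⟨c, h1, h2⟩
  · exact .inl ⟨ofList c, h1, h2⟩
  · by_cases hc : c = []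
    · subst hc
      exact .inl ⟨1, by simpa using h1.symm, by simpa using h2.symm⟩
    · exact .inr ⟨ofList c, hc, h1, h2⟩

lemma eq_one_or_eq_of_mul_eq {a b u v : FreeMonoid α} {y : α} (h : a * u * b = v * of y) :
    b = 1 ∨ ∃ b', b = b' * of y ∧ a * u * b' = v := by
  by_cases hb : b = 1
  · exact .inl hb
  · obtain ⟨b', z, rfl⟩ := exists_eq_mul_of hb
    rw [← mul_assoc] at h
    have h' : (a * u * b').toList ++ [z] = v.toList ++ [y] := h
    obtain ⟨h1, h2⟩ := List.append_inj' h' rfl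
    exact .inr ⟨b', by rw [List.singleton_inj.1 h2], h1⟩

lemma eq_one_or_eq_mul_of_eq {a b u v : FreeMonoid α} {x : α} (h : a * u * b = of x * v) :
    a = 1 ∨ ∃ a', a = of x * a' ∧ a' * u * b = v := by
  by_cases ha : a = 1
  · exact .inl ha
  · obtain ⟨z, a', rfl⟩ := exists_eq_of_mul ha
    rw [mul_assoc (of z), mul_assoc (of z)] at h
    have h' : z :: (a' * u * b).toList = x :: v.toList := h
    obtain ⟨h1, h2⟩ := List.cons.inj h'
    exact .inr ⟨a', by rw [h1], h2⟩

end FreeMonoid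

/-! ### Divisions detecting all overlaps -/

namespace InvDivision

open FreeMonoid

variable {n : ℕ} {I : InvDivision n}

lemma DividesAt.mem_right {U : Finset (NCMon n)} {u a b : NCMon n} {y : Fin n}
    (h : I.DividesAt U u a (of y * b)) : y ∈ I.right U u := h.2 y rfl

lemma DividesAt.mem_left {U : Finset (NCMon n)} {u a b : NCMon n} {x : Fin n}
    (h : I.DividesAt U u (a * of x) b) : x ∈ I.left U u := h.1 x (by simp)

/-- The letter to the right of a proper occurrence of one member of `U` in another, or the letter
before it if it is a suffix, is nonmultiplicative, and wherever a suffix of one member overlaps a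
prefix of another one (or of the same), at least one of the two letters adjacent to the common part
is nonmultiplicative on its side. -/
structure DetectsOverlaps (I : InvDivision n) : Prop where
  subword : ∀ (U : Finset (NCMon n)) (u a b : NCMon n) (y : Fin n), u ∈ U →
    a * u * (of y * b) ∈ U → y ∉ I.right U u
  suffix : ∀ (U : Finset (NCMon n)) (u a : NCMon n) (x : Fin n), u ∈ U →
    a * of x * u ∈ U → x ∉ I.left U u
  overlap : ∀ (U : Finset (NCMon n)) (l v r : NCMon n) (x y : Fin n), v ≠ 1 →
    l * of x * v ∈ U → v * (of y * r) ∈ U →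
      x ∉ I.left U (v * (of y * r)) ∨ y ∉ I.right U (l * of x * v)

variable {K : Type*} [Field K] {O : AdmissibleOrder n} {P : Finset (NCPoly K n)}

lemma LM_mem_LMs {p : NCPoly K n} (hp : p ∈ P) : O.LM p ∈ O.LMs P := by
  classical
  exact Finset.mem_image_of_mem _ hp

/-- If `w` itself is the leading monomial of `q₀ ∈ P`, every occurrence in `w` is equivalent to
`q₀`: prolonging to the right moves an occurrence to the right until it is a suffix, as an
involutive occurrence with a letter to its right is impossible inside `w`; then prolonging to the
left lengthens the suffix until it is all of `w`. -/
lemma monicMul_sub_mem_of_eq_LM (hI : I.DetectsOverlaps) (h : I.IsLocallyInvolutiveBasis O P)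
    {q₀ : NCPoly K n} (hq₀ : q₀ ∈ P) {q : NCPoly K n} (hq : q ∈ P) {a b : NCMon n}
    (hw : a * O.LM q * b = O.LM q₀) :
    O.monicMul a q b - O.monicMul 1 q₀ 1 ∈ O.lowerSpan P (O.LM q₀) := by
  by_cases hb : b = 1
  · subst hb
    by_cases ha : a = 1
    · subst ha
      rw [h.LM_injOn hq hq₀ (by simpa using hw), sub_self]
      exact zero_mem _
    obtain ⟨a, x, rfl⟩ := exists_eq_mul_of ha
    rw [mul_one] at hw
    have hx : x ∉ I.left (O.LMs P) (O.LM q) :=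
      hI.suffix _ _ a _ (LM_mem_LMs hq) (hw ▸ LM_mem_LMs hq₀)
    obtain ⟨q₁, hq₁, a₁, b₁, heq, hdiv, hmem⟩ := h.exists_of_notMem_left hq hx
    have hw₁ : a * a₁ * O.LM q₁ * b₁ = O.LM q₀ := by
      rw [← hw, mul_assoc a (of x), ← heq]
      simp only [mul_assoc]
    have hb₁ : b₁ = 1 := by
      by_contra hne
      obtain ⟨y, b', rfl⟩ := exists_eq_of_mul hne
      exact hI.subword _ _ (a * a₁) b' y (LM_mem_LMs hq₁) (hw₁ ▸ LM_mem_LMs hq₀) hdiv.mem_right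
    subst hb₁
    have ha₁ : a₁ = 1 := by
      by_contra hne
      obtain ⟨a', z, rfl⟩ := exists_eq_mul_of hne
      refine hI.suffix _ _ (a * a') z (LM_mem_LMs hq₁) ?_ hdiv.mem_left
      rw [mul_one] at hw₁
      rw [mul_assoc a, hw₁]
      exact LM_mem_LMs hq₀
    subst ha₁
    have hrec := monicMul_sub_mem_of_eq_LM hI h hq₀ hq₁ (a := a) (b := 1) (by simpa using hw₁)
    have hstep := O.monicMul_sub_monicMul_mem_mul hmem a 1
    rw [mul_one, mul_one, mul_one, ← mul_assoc, hw] at hstep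
    simpa using add_mem hstep hrec
  · obtain ⟨y, b, rfl⟩ := exists_eq_of_mul hb
    have hy : y ∉ I.right (O.LMs P) (O.LM q) :=
      hI.subword _ _ a b _ (LM_mem_LMs hq) (hw ▸ LM_mem_LMs hq₀)
    obtain ⟨q₁, hq₁, a₁, b₁, heq, hdiv, hmem⟩ := h.exists_of_notMem_right hq hy
    have hw₁ : a * a₁ * O.LM q₁ * (b₁ * b) = O.LM q₀ := by
      have : a * (a₁ * O.LM q₁ * b₁) * b = O.LM q₀ := by
        rw [← hw, heq]
        simp only [mul_assoc]
      simpa only [mul_assoc] using this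
    have hb₁ : b₁ = 1 := by
      by_contra hne
      obtain ⟨z, b', rfl⟩ := exists_eq_of_mul hne
      refine hI.subword _ _ (a * a₁) (b' * b) z (LM_mem_LMs hq₁) ?_ hdiv.mem_right
      rw [← mul_assoc (of z), hw₁]
      exact LM_mem_LMs hq₀
    subst hb₁
    have hrec := monicMul_sub_mem_of_eq_LM hI h hq₀ hq₁ (a := a * a₁) (b := b)
      (by simpa using hw₁)
    have hstep := O.monicMul_sub_monicMul_mem_mul hmem a b
    have hw' : a * (O.LM q * of y) * b = O.LM q₀ := by simpa only [mul_assoc] using hw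
    rw [mul_one, one_mul, hw'] at hstep
    simpa using add_mem hstep hrec
termination_by (b.length, a.length)
decreasing_by
  · subst_vars
    exact Prod.Lex.right _ (by simp)
  · subst_vars
    exact Prod.Lex.left _ _ (by simp)

lemma sub_mem_of_left_common {w : NCMon n} (hIH : ∀ v, O.ord.lt v w → O.Resolves P v)
    {q q' : NCPoly K n} (hq : q ∈ P) (hq' : q' ∈ P) {a b a' b' : NCMon n} (ha : a ≠ 1)
    (ha' : a' ≠ 1) (hw : a * O.LM q * b = w) (hw' : a' * O.LM q' * b' = w) :
    O.monicMul a q b - O.monicMul a' q' b' ∈ O.lowerSpan P w := by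
  obtain ⟨x, a, rfl⟩ := exists_eq_of_mul ha
  have hw'' : a' * O.LM q' * b' = of x * (a * O.LM q * b) := by
    rw [hw', ← hw]
    simp only [mul_assoc]
  obtain ⟨a', rfl, heq⟩ := (eq_one_or_eq_mul_of_eq hw'').resolve_left ha'
  have hlt : O.ord.lt (a * O.LM q * b) w := by
    have := O.self_lt_mul (l := of x) (r := 1) (.inl (by simp)) (a * O.LM q * b)
    rw [← hw]
    simpa only [mul_assoc, mul_one] using this
  have := O.monicMul_sub_monicMul_mem_mul (hIH _ hlt q hq q' hq' a b a' b' rfl heq) (of x) 1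
  rw [← hw]
  simpa only [mul_assoc, mul_one] using this

lemma sub_mem_of_right_common {w : NCMon n} (hIH : ∀ v, O.ord.lt v w → O.Resolves P v)
    {q q' : NCPoly K n} (hq : q ∈ P) (hq' : q' ∈ P) {a b a' b' : NCMon n} (hb : b ≠ 1)
    (hb' : b' ≠ 1) (hw : a * O.LM q * b = w) (hw' : a' * O.LM q' * b' = w) :
    O.monicMul a q b - O.monicMul a' q' b' ∈ O.lowerSpan P w := by
  obtain ⟨b, x, rfl⟩ := exists_eq_mul_of hb
  have hw'' : a' * O.LM q' * b' = a * O.LM q * b * of x := by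
    rw [hw', ← hw]
    simp only [mul_assoc]
  obtain ⟨b', rfl, heq⟩ := (eq_one_or_eq_of_mul_eq hw'').resolve_left hb'
  have hlt : O.ord.lt (a * O.LM q * b) w := by
    have := O.self_lt_mul (l := 1) (r := of x) (.inr (by simp)) (a * O.LM q * b)
    rw [← hw]
    simpa only [mul_assoc, one_mul] using this
  have := O.monicMul_sub_monicMul_mem_mul (hIH _ hlt q hq q' hq' a b a' b' rfl heq) 1 (of x)
  rw [← hw]
  simpa only [mul_assoc, one_mul] using this

/-- If `w` is not the leading monomial of a member of `P` and the smaller words are settled, a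
prefix occurrence and a suffix occurrence in `w` are equivalent: if they overlap, prolonging one of
them gives an occurrence that meets the other one in a proper subword, or a longer prefix or
suffix. -/
lemma monicMul_sub_mem_of_prefix_suffix (hI : I.DetectsOverlaps)
    (h : I.IsLocallyInvolutiveBasis O P) {w : NCMon n}
    (hIH : ∀ v, O.ord.lt v w → O.Resolves P v) (hne : ∀ q ∈ P, O.LM q ≠ w)
    {p q : NCPoly K n} (hp : p ∈ P) (hq : q ∈ P) {a b : NCMon n}
    (hpw : O.LM p * b = w) (hqw : a * O.LM q = w) :
    O.monicMul 1 p b - O.monicMul a q 1 ∈ O.lowerSpan P w := by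
  rcases disjoint_or_overlap (hpw.trans hqw.symm) with ⟨c, rfl, rfl⟩ | ⟨c, hc, hpc, hqc⟩
  · have := O.monicMul_sub_monicMul_mem_of_disjoint hp hq
      (ne_of_mem_of_not_mem hp h.zero_notMem) (ne_of_mem_of_not_mem hq h.zero_notMem) c
    rwa [hqw] at this
  have hb : b ≠ 1 := fun hb => hne p hp (by simpa [hb] using hpw)
  have ha : a ≠ 1 := fun ha => hne q hq (by simpa [ha] using hqw)
  obtain ⟨y, b, rfl⟩ := exists_eq_of_mul hb
  obtain ⟨a, x, rfl⟩ := exists_eq_mul_of ha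
  rcases hI.overlap (O.LMs P) a c b x y hc (hpc ▸ LM_mem_LMs hp) (hqc ▸ LM_mem_LMs hq)
    with hx | hy
  · rw [← hqc] at hx
    obtain ⟨q₁, hq₁, a₁, b₁, heq, hdiv, hmem⟩ := h.exists_of_notMem_left hq hx
    have hstep := O.monicMul_sub_monicMul_mem_mul hmem a 1
    rw [mul_one, mul_one, mul_one, ← mul_assoc, hqw] at hstep
    have hw₁ : a * a₁ * O.LM q₁ * b₁ = w := by
      rw [← hqw, mul_assoc a (of x), ← heq]
      simp only [mul_assoc]
    suffices hrec : O.monicMul 1 p (of y * b) - O.monicMul (a * a₁) q₁ b₁ ∈ O.lowerSpan P w by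
      simpa using sub_mem hrec hstep
    by_cases hb₁ : b₁ = 1
    · subst hb₁
      rcases eq_one_or_eq_mul_of_eq heq with rfl | ⟨a', rfl, heq'⟩
      · exact monicMul_sub_mem_of_prefix_suffix hI h hIH hne hp hq₁ hpw (by simpa using hw₁)
      -- a proper suffix of `x * LM q` with a left multiplicative letter before it
      exfalso
      by_cases ha' : a' = 1
      · subst ha'
        have : O.LM q₁ = O.LM q := by simpa using heq'
        rw [← this] at hx
        exact hx (hdiv.mem_left (a := 1))
      · obtain ⟨a', z, rfl⟩ := exists_eq_mul_of ha'
        rw [mul_one] at heq'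
        rw [← mul_assoc] at hdiv
        exact hI.suffix _ _ a' z (LM_mem_LMs hq₁) (heq' ▸ LM_mem_LMs hq) hdiv.mem_left
    · exact sub_mem_of_right_common hIH hp hq₁ hb hb₁ (by simpa using hpw) hw₁
  · rw [← hpc] at hy
    obtain ⟨q₁, hq₁, a₁, b₁, heq, hdiv, hmem⟩ := h.exists_of_notMem_right hp hy
    have hstep := O.monicMul_sub_monicMul_mem_mul hmem 1 b
    have hpw' : O.LM p * of y * b = w := by rw [← hpw, mul_assoc]
    rw [one_mul, one_mul, one_mul, hpw'] at hstep
    have hw₁ : a₁ * O.LM q₁ * (b₁ * b) = w := by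
      rw [← hpw', ← heq]
      simp only [mul_assoc]
    suffices hrec : O.monicMul a₁ q₁ (b₁ * b) - O.monicMul (a * of x) q 1 ∈ O.lowerSpan P w by
      simpa using add_mem hstep hrec
    by_cases ha₁ : a₁ = 1
    · subst ha₁
      rcases eq_one_or_eq_of_mul_eq heq with rfl | ⟨b', rfl, heq'⟩
      · rw [one_mul]
        exact monicMul_sub_mem_of_prefix_suffix hI h hIH hne hq₁ hq (by simpa using hw₁) hqw
      -- a proper prefix of `LM p * y` with a right multiplicative letter after it
      exfalso
      by_cases hb' : b' = 1
      · subst hb'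
        have : O.LM q₁ = O.LM p := by simpa using heq'
        rw [← this] at hy
        exact hy (hdiv.mem_right (b := 1))
      · obtain ⟨z, b', rfl⟩ := exists_eq_of_mul hb'
        rw [mul_assoc (of z)] at hdiv
        exact hI.subword _ _ 1 b' z (LM_mem_LMs hq₁) (heq' ▸ LM_mem_LMs hp) hdiv.mem_right
    · exact sub_mem_of_left_common hIH hq₁ hq ha₁ ha hw₁ (by simpa using hqw)
termination_by a.length + b.length
decreasing_by
  all_goals
    subst_vars
    simp

lemma resolves_of_isLocallyInvolutiveBasis (hI : I.DetectsOverlaps)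
    (h : I.IsLocallyInvolutiveBasis O P) (w : NCMon n) : O.Resolves P w := by
  induction w using O.wellFounded_lt.induction with
  | _ w hIH =>
    intro p hp q hq a b a' b' hpw hqw
    by_cases hfull : ∃ q₀ ∈ P, O.LM q₀ = w
    · obtain ⟨q₀, hq₀, rfl⟩ := hfull
      simpa using sub_mem (monicMul_sub_mem_of_eq_LM hI h hq₀ hp hpw)
        (monicMul_sub_mem_of_eq_LM hI h hq₀ hq hqw)
    have hne : ∀ q ∈ P, O.LM q ≠ w := fun q hq he => hfull ⟨q, hq, he⟩
    by_cases ha : a = 1 <;> by_cases hb' : b' = 1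
    · subst ha hb'
      exact monicMul_sub_mem_of_prefix_suffix hI h hIH hne hp hq (by simpa using hpw)
        (by simpa using hqw)
    · subst ha
      have hb : b ≠ 1 := fun hb => hne p hp (by simpa [hb] using hpw)
      exact sub_mem_of_right_common hIH hp hq hb hb' hpw hqw
    · subst hb'
      have ha' : a' ≠ 1 := fun ha' => hne q hq (by simpa [ha'] using hqw)
      exact sub_mem_of_left_common hIH hp hq ha ha' hpw hqw
    · by_cases ha' : a' = 1
      · by_cases hb : b = 1
        · subst ha' hb
          rw [← neg_sub]
          exact neg_mem (monicMul_sub_mem_of_prefix_suffix hI h hIH hne hq hp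
            (by simpa using hqw) (by simpa using hpw))
        · exact sub_mem_of_right_common hIH hp hq hb hb' hpw hqw
      · exact sub_mem_of_left_common hIH hp hq ha ha' hpw hqw

theorem isGroebnerBasis_of_detectsOverlaps (hI : I.DetectsOverlaps)
    (h : I.IsLocallyInvolutiveBasis O P) :
    IsGroebnerBasis O P (TwoSidedIdeal.span (P : Set (NCPoly K n))) :=
  O.isGroebnerBasis_of_resolves h.zero_notMem (resolves_of_isLocallyInvolutiveBasis hI h)

end InvDivision

/-! ### The two-sided left overlap division detects overlaps -/

namespace List

variable {α β : Type*} [Preorder β]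

lemma foldl_le_of_decreasing {f : β → α → β} (hf : ∀ T a, f T a ≤ T) (l : List α) (T : β) :
    l.foldl f T ≤ T := by
  induction l generalizing T with
  | nil => exact le_refl T
  | cons a l ih => exact (ih _).trans (hf T a)

lemma exists_foldl_le_of_mem {f : β → α → β} (hf : ∀ T a, f T a ≤ T) {l : List α} {a : α}
    (ha : a ∈ l) (T : β) : ∃ T₀, l.foldl f T ≤ f T₀ a := by
  obtain ⟨l₁, l₂, rfl⟩ := List.append_of_mem ha
  rw [List.foldl_append, List.foldl_cons]
  exact ⟨_, foldl_le_of_decreasing hf _ _⟩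

end List

namespace TwoSidedLeftOverlap

open FreeMonoid

variable {n : ℕ}

/-! Tables are compared pointwise, with `false ≤ true`. -/

lemma Table.clear_le (T : Table n) (u : NCMon n) (s : Side) (x : Fin n) : T.clear u s x ≤ T := by
  intro u' s' x'
  unfold Table.clear
  split_ifs
  · exact Bool.false_le _
  · exact le_refl _

lemma Table.clear_self (T : Table n) (u : NCMon n) (s : Side) (x : Fin n) :
    T.clear u s x u s x = false := by
  simp [Table.clear]

lemma Table.eq_false_of_le {T T' : Table n} (h : T ≤ T') {u : NCMon n} {s : Side} {x : Fin n}
    (hf : T' u s x = false) : T u s x = false := by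
  have := h u s x
  rw [hf] at this
  exact le_bot_iff.1 this

lemma subwordStep_le (u u' : NCMon n) (T : Table n) (k : ℕ) : subwordStep u u' T k ≤ T := by
  unfold subwordStep Table.clear?
  split_ifs
  · split
    exacts [T.clear_le _ _ _, le_refl _]
  · split
    exacts [T.clear_le _ _ _, le_refl _]
  · exact le_refl _

lemma prefixStep_le (u u' : NCMon n) (T : Table n) (k : ℕ) : prefixStep u u' T k ≤ T := by
  unfold prefixStep
  split_ifs
  · split
    · split_ifs
      exacts [T.clear_le _ _ _, le_refl _]
    · exact le_refl _
  · exact le_refl _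

lemma suffixStep_le (u u' : NCMon n) (T : Table n) (k : ℕ) : suffixStep u u' T k ≤ T := by
  unfold suffixStep
  split_ifs
  · split
    · split_ifs
      exacts [T.clear_le _ _ _, le_refl _]
    · exact le_refl _
  · exact le_refl _

lemma overlapStep_le (u u' : NCMon n) (T : Table n) (k : ℕ) :
    suffixStep u u' (prefixStep u u' T k) k ≤ T :=
  (suffixStep_le _ _ _ _).trans (prefixStep_le _ _ _ _)

lemma pairStep_le (u : NCMon n) (T : Table n) (u' : NCMon n) : pairStep u T u' ≤ T := by
  refine (List.foldl_le_of_decreasing (overlapStep_le u u') _ _).trans ?_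
  split_ifs
  · exact List.foldl_le_of_decreasing (subwordStep_le u u') _ _
  · exact le_refl _

lemma exists_pairStep_le_subwordStep {u u' : NCMon n} (hne : u ≠ u') {k : ℕ}
    (hk : k ∈ List.range' 1 (u.length + 1 - u'.length)) (T : Table n) :
    ∃ T₀, pairStep u T u' ≤ subwordStep u u' T₀ k := by
  obtain ⟨T₀, h⟩ := List.exists_foldl_le_of_mem (subwordStep_le u u') hk T
  refine ⟨T₀, (List.foldl_le_of_decreasing (overlapStep_le u u') _ _).trans ?_⟩
  rwa [if_pos hne]

lemma exists_pairStep_le_overlapStep {u u' : NCMon n} {k : ℕ}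
    (hk : k ∈ List.range' 1 (u'.length - 1)) (T : Table n) :
    ∃ T₀, pairStep u T u' ≤ suffixStep u u' (prefixStep u u' T₀ k) k :=
  List.exists_foldl_le_of_mem (overlapStep_le u u') hk _

lemma run_le (l : List (NCMon n)) (T : Table n) : run l T ≤ T := by
  induction l generalizing T with
  | nil => exact le_refl T
  | cons u l ih => exact (ih _).trans (List.foldl_le_of_decreasing (pairStep_le u) _ _)

lemma exists_run_le (l₁ : List (NCMon n)) {u u' : NCMon n} {l₂ : List (NCMon n)}
    (hu' : u' ∈ u :: l₂) (T : Table n) : ∃ T₀, run (l₁ ++ u :: l₂) T ≤ pairStep u T₀ u' := by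
  induction l₁ generalizing T with
  | nil =>
    obtain ⟨T₀, h⟩ := List.exists_foldl_le_of_mem (pairStep_le u) hu' T
    exact ⟨T₀, (run_le l₂ _).trans h⟩
  | cons a l₁ ih => exact ih _

lemma exists_table_le {U : Finset (NCMon n)} {u u' : NCMon n} (hu : u ∈ U) (hu' : u' ∈ U)
    (h : DegRevLexGE u u') : ∃ T₀, table U ≤ pairStep u T₀ u' := by
  have hsorted : (U.sort DegRevLexGE).Pairwise DegRevLexGE := U.pairwise_sort DegRevLexGE
  obtain ⟨l₁, l₂, hl⟩ := List.append_of_mem ((Finset.mem_sort DegRevLexGE).2 hu)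
  have hmem : u' ∈ l₁ ++ u :: l₂ := hl ▸ (Finset.mem_sort DegRevLexGE).2 hu'
  rw [table, hl]
  refine exists_run_le l₁ ?_ _
  rcases List.mem_append.1 hmem with h₁ | h₂
  · rw [hl, List.pairwise_append] at hsorted
    have := hsorted.2.2 u' h₁ u List.mem_cons_self
    rw [Std.Antisymm.antisymm u' u this h]
    exact List.mem_cons_self
  · exact h₂

lemma degRevLexGE_of_length_lt {u v : NCMon n} (h : v.length < u.length) : DegRevLexGE u v :=
  (Prod.Lex.toLex_lt_toLex.2 (.inl h)).le

lemma subwordStep_right (a u b : NCMon n) (y : Fin n) (T : Table n) :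
    subwordStep (a * u * (of y * b)) u T (a.length + 1) u .R y = false := by
  have hsub : sub (a * u * (of y * b)) (a.length + 1) (a.length + 1 + u.length - 1) =
      u.toList := by
    have : a.length + 1 + u.length - 1 + 1 - (a.length + 1) = u.length := by omega
    simp only [sub, this, mul_assoc, toList_mul, Nat.add_sub_cancel]
    change List.take u.toList.length (List.drop a.toList.length _) = u.toList
    rw [List.drop_left' (l₁ := a.toList) rfl, List.take_left' (l₁ := u.toList) rfl]
  have hlt : a.length + 1 < (a * u * (of y * b)).length + 1 - u.length := by
    simp only [length_mul, length_of]
    omega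
  have hletter : letter (a * u * (of y * b)) (a.length + 1 + u.length) = some y := by
    have : a.length + 1 + u.length - 1 = (a * u).toList.length := by
      change _ = (a * u).length
      rw [length_mul]
      omega
    rw [letter, if_neg (by omega), this, toList_mul, List.getElem?_append_right (le_refl _)]
    simp
  rw [subwordStep, if_pos hsub, if_pos hlt, hletter]
  exact Table.clear_self _ _ _ _

lemma subwordStep_left (a u : NCMon n) (x : Fin n) (T : Table n) :
    subwordStep (a * of x * u) u T (a.length + 2) u .L x = false := by
  have hsub : sub (a * of x * u) (a.length + 2) (a.length + 2 + u.length - 1) = u.toList := by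
    have : a.length + 2 + u.length - 1 + 1 - (a.length + 2) = u.length := by omega
    simp only [sub, this]
    rw [toList_mul, List.drop_left' (by simp [length])]
    exact List.take_of_length_le (le_refl _)
  have hlt : ¬ a.length + 2 < (a * of x * u).length + 1 - u.length := by
    simp only [length_mul, length_of]
    omega
  have hletter : letter (a * of x * u) (a.length + 2 - 1) = some x := by
    have : a.length + 2 - 1 - 1 = a.toList.length := by
      change _ = a.length
      omega
    rw [letter, if_neg (by omega), this, mul_assoc, toList_mul,
      List.getElem?_append_right (le_refl _)]
    simp
  rw [subwordStep, if_pos hsub, if_neg hlt, hletter]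
  exact Table.clear_self _ _ _ _

section Overlap

variable (l v r : NCMon n) (x y : Fin n)

lemma pre_mul : pre (v * r) v.length = v.toList := by
  rw [pre, toList_mul]
  exact List.take_left' rfl

lemma suff_mul : suff (l * v) v.length = v.toList := by
  have : (l * v).length - v.length = l.length := by simp
  rw [suff, this, toList_mul]
  exact List.drop_left' rfl

lemma letter_after : letter (v * (of y * r)) (v.length + 1) = some y := by
  rw [letter, if_neg (by omega), Nat.add_sub_cancel, toList_mul]
  refine (List.getElem?_append_right (le_refl v.toList.length)).trans ?_
  simp

lemma letter_before : letter (l * of x * v) ((l * of x * v).length - v.length) = some x := by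
  have : (l * of x * v).length - v.length = l.length + 1 := by simp
  rw [this, letter, if_neg (by omega), Nat.add_sub_cancel, mul_assoc, toList_mul]
  refine (List.getElem?_append_right (le_refl l.toList.length)).trans ?_
  simp

lemma prefixStep_overlap (T : Table n) :
    prefixStep (v * (of y * r)) (l * of x * v) T v.length (v * (of y * r)) .L x = false ∨
      prefixStep (v * (of y * r)) (l * of x * v) T v.length (l * of x * v) .R y = false := by
  rw [prefixStep, if_pos ((pre_mul _ _).trans (suff_mul _ _).symm), letter_before, letter_after]
  dsimp only
  split_ifs with h
  · exact .inr (Table.clear_self _ _ _ _)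
  · simpa [Bool.and_eq_true, -not_and, not_and_or] using h

lemma suffixStep_overlap (T : Table n) :
    suffixStep (l * of x * v) (v * (of y * r)) T v.length (v * (of y * r)) .L x = false ∨
      suffixStep (l * of x * v) (v * (of y * r)) T v.length (l * of x * v) .R y = false := by
  rw [suffixStep, if_pos ((suff_mul _ _).trans (pre_mul _ _).symm), letter_before, letter_after]
  dsimp only
  split_ifs with h
  · exact .inl (Table.clear_self _ _ _ _)
  · simpa [Bool.and_eq_true, -not_and, not_and_or, or_comm] using h

end Overlap

lemma notMem_left_iff {U : Finset (NCMon n)} {u : NCMon n} {x : Fin n} :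
    x ∉ (twoSidedLeftOverlapDivision n).left U u ↔ table U u .L x = false := by
  simp [twoSidedLeftOverlapDivision]

lemma notMem_right_iff {U : Finset (NCMon n)} {u : NCMon n} {x : Fin n} :
    x ∉ (twoSidedLeftOverlapDivision n).right U u ↔ table U u .R x = false := by
  simp [twoSidedLeftOverlapDivision]

/-- Multiplicative variables are only ever removed, so whatever one step of the double loop makes
nonmultiplicative remains so in the final table. -/
theorem detectsOverlaps : (twoSidedLeftOverlapDivision n).DetectsOverlaps where
  subword U u a b y hu hw := by
    have hlt : u.length < (a * u * (of y * b)).length := by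
      simp only [length_mul, length_of]
      omega
    obtain ⟨T₀, h₀⟩ := exists_table_le hw hu (degRevLexGE_of_length_lt hlt)
    obtain ⟨T₁, h₁⟩ := exists_pairStep_le_subwordStep (k := a.length + 1)
      (fun h => hlt.ne (congrArg length h).symm)
      (by simp only [List.mem_range'_1, length_mul, length_of]; omega) T₀
    exact notMem_right_iff.2 (Table.eq_false_of_le (h₀.trans h₁) (subwordStep_right a u b y T₁))
  suffix U u a x hu hw := by
    have hlt : u.length < (a * of x * u).length := by
      simp only [length_mul, length_of]
      omega
    obtain ⟨T₀, h₀⟩ := exists_table_le hw hu (degRevLexGE_of_length_lt hlt)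
    obtain ⟨T₁, h₁⟩ := exists_pairStep_le_subwordStep (k := a.length + 2)
      (fun h => hlt.ne (congrArg length h).symm)
      (by simp only [List.mem_range'_1, length_mul, length_of]; omega) T₀
    exact notMem_left_iff.2 (Table.eq_false_of_le (h₀.trans h₁) (subwordStep_left a u x T₁))
  overlap U l v r x y hv hu' hu := by
    have hpos : 0 < v.length := Nat.pos_of_ne_zero fun h => hv (length_eq_zero.1 h)
    rw [notMem_left_iff, notMem_right_iff]
    rcases total_of DegRevLexGE (v * (of y * r)) (l * of x * v) with h | h
    · obtain ⟨T₀, h₀⟩ := exists_table_le hu hu' h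
      obtain ⟨T₁, h₁⟩ := exists_pairStep_le_overlapStep (k := v.length)
        (u := v * (of y * r)) (u' := l * of x * v)
        (by simp only [List.mem_range'_1, length_mul, length_of]; omega) T₀
      have hle := h₀.trans (h₁.trans (suffixStep_le _ _ _ _))
      exact (prefixStep_overlap l v r x y T₁).imp (Table.eq_false_of_le hle)
        (Table.eq_false_of_le hle)
    · obtain ⟨T₀, h₀⟩ := exists_table_le hu' hu h
      obtain ⟨T₁, h₁⟩ := exists_pairStep_le_overlapStep (k := v.length)
        (u := l * of x * v) (u' := v * (of y * r))
        (by simp only [List.mem_range'_1, length_mul, length_of]; omega) T₀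
      have hle := h₀.trans h₁
      exact (suffixStep_overlap l v r x y _).imp (Table.eq_false_of_le hle)
        (Table.eq_false_of_le hle)

lemma table_singleton_of (x : Fin n) : table {of x} = fun _ _ _ => true := by
  simp [table, run, pairStep]

/-- For `U = {x}` all variables are multiplicative, and `x` divides `x * x` at two places. -/
theorem isWeak (hn : 1 ≤ n) : (twoSidedLeftOverlapDivision n).IsWeak := by
  intro hs
  let x : Fin n := ⟨0, hn⟩
  have hdiv : ∀ a b : NCMon n, (twoSidedLeftOverlapDivision n).DividesAt {of x} (of x) a b := by
    intro a b
    constructor <;> intro y _ <;> simp [twoSidedLeftOverlapDivision, table_singleton_of]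
  have := hs.unique_divisor {of x} (of x) (Finset.mem_singleton_self _) (of x) 1 1 (of x)
    (by simp) (hdiv _ _) (hdiv _ _)
  exact of_ne_one x this.1

end TwoSidedLeftOverlap

theorem mainTheorem8 (K : Type*) [Field K] (n : ℕ) (hn : 1 ≤ n) :
    (twoSidedLeftOverlapDivision n).IsGroebnerDivision K := by
  exact ⟨TwoSidedLeftOverlap.isWeak hn, fun O P h =>
    InvDivision.isGroebnerBasis_of_detectsOverlaps TwoSidedLeftOverlap.detectsOverlaps h⟩
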